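/- **Setting.** An instance of the Student-Project Allocation problem with lecturer preferences over students (SPA-S) consists of finite sets of students, projects and lecturers. Each student $s$ ranks a subset $A_s$ of the projects (those acceptable to $s$) in strict order. Each project $p$ is offered by exactly one lecturer, and each lecturer $l$ offers a non-empty set $P_l$ of projects and ranks in strict order exactly those students who find at least one project in $P_l$ acceptable. Projects have capacities $c_p\in\mathbb Z^+$ and lecturers have capacities $d_l\in\mathbb Z^+$, with $\max_{p\in P_l}c_p\le d_l\le\sum_{p\in P_l}c_p$. An assignment is a set $M$ of pairs $(s,p)$ with $p\in A_s$; $M(s)$ is the set of projects assigned to $s$, $M(p)$ the set of students assigned to $p$, and $M(l)$ the set of students assigned to a project offered by $l$. $M$ is a matching if $|M(s)|\le 1$, $|M(p)|\le c_p$ and $|M(l)|\le d_l$ for all $s,p,l$. A project $p$ is undersubscribed (full) in $M$ if $|M(p)|<c_p$ (resp. $|M(p)|=c_p$), and similarly for a lecturer $l$ with $d_l$. A pair $(s,p)\notin M$ with $p\in A_s$, where $p$ is offered by $l$, is a blocking pair for $M$ if * (S1) $s$ is unassigned in $M$, or (S2) $s$ is assigned in $M$ and prefers $p$ to $M(s)$;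 and one of the following holds: * (P1) $p$ and $l$ are both undersubscribed in $M$; * (P2) $p$ is undersubscribed in $M$, $l$ is full in $M$, and $s\in M(l)$; * (P3) $p$ is undersubscribed in $M$, $l$ is full in $M$, and $l$ prefers $s$ to the worst student in $M(l)$; * (P4) $p$ is full in $M$, and $l$ prefers $s$ to the worst student in $M(p)$. A matching is stable if it admits no blocking pair. **Lemma.** Let $M$ and $M'$ be stable matchings in an instance of SPA-S, and let $M\vee M'$ be the assignment in which a student unassigned in both $M$ and $M'$ is unassigned, a student assigned to the same project in $M$ and $M'$ is assigned to that project, and every other student is assigned to the less preferred of their projects in $M$ and $M'$. Then $M\vee M'$ is a matching and admits no blocking pair (of any of the types obtained by combining S1 or S2 with one of P1–P4); that is, $M\vee M'$ is a stable matching. -/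

import Mathlib

/-- `Precedes l a b`: both `a` and `b` occur in the preference list `l`, and `a` occurs
strictly before `b`. -/
def Precedes {α : Type*} [DecidableEq α] (l : List α) (a b : α) : Prop :=
  a ∈ l ∧ b ∈ l ∧ l.idxOf a < l.idxOf b

/-- An instance of the Student-Project Allocation problem with lecturer preferences over
students, with students `S`, projects `P` and lecturers `L`. -/
structure SPAInstance (S P L : Type*) [Fintype S] [Fintype P] [Fintype L]
    [DecidableEq S] [DecidableEq P] [DecidableEq L] where
  /-- The strictly ordered preference list of a student; its entries are the projects that the
  student finds acceptable. -/
  studentList : S → List P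
  studentList_nodup : ∀ s, (studentList s).Nodup
  /-- The unique lecturer offering a project. -/
  lecturer : P → L
  /-- Every lecturer offers at least one project. -/
  lecturer_surjective : Function.Surjective lecturer
  /-- The strictly ordered preference list of a lecturer. -/
  lecturerList : L → List S
  lecturerList_nodup : ∀ l, (lecturerList l).Nodup
  /-- A lecturer ranks exactly the students who find one of the lecturer's projects acceptable. -/
  mem_lecturerList : ∀ l s, s ∈ lecturerList l ↔ ∃ p ∈ studentList s, lecturer p = l
  /-- The capacity of a project. -/
  projectCap : P → ℕ
  projectCap_pos : ∀ p, 0 < projectCap p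
  /-- The capacity of a lecturer. -/
  lecturerCap : L → ℕ
  lecturerCap_pos : ∀ l, 0 < lecturerCap l
  /-- A lecturer's capacity is at least the capacity of each of the lecturer's projects. -/
  projectCap_le : ∀ p, projectCap p ≤ lecturerCap (lecturer p)
  /-- A lecturer's capacity is at most the total capacity of the lecturer's projects. -/
  lecturerCap_le : ∀ l,
    lecturerCap l ≤ ∑ p ∈ Finset.univ.filter (fun p => lecturer p = l), projectCap p

namespace SPAInstance

variable {S P L : Type*} [Fintype S] [Fintype P] [Fintype L]
  [DecidableEq S] [DecidableEq P] [DecidableEq L]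

/-- Student `s` prefers project `p` to project `q`. -/
def StudentPrefers (I : SPAInstance S P L) (s : S) (p q : P) : Prop :=
  Precedes (I.studentList s) p q

/-- Lecturer `l` prefers student `s` to student `t`. -/
def LecturerPrefers (I : SPAInstance S P L) (l : L) (s t : S) : Prop :=
  Precedes (I.lecturerList l) s t

/-- `(s, p)` is an acceptable pair: `s` finds `p` acceptable, and the lecturer offering `p` finds
`s` acceptable. -/
def Acceptable (I : SPAInstance S P L) (s : S) (p : P) : Prop :=
  p ∈ I.studentList s ∧ s ∈ I.lecturerList (I.lecturer p)

/-- `M` is an assignment: it pairs students only with projects that they find acceptable. -/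
def IsAssignment (I : SPAInstance S P L) (M : Finset (S × P)) : Prop :=
  ∀ s p, (s, p) ∈ M → p ∈ I.studentList s

/-- `M(s)`: the projects assigned to the student `s`. -/
def projectsOf (_I : SPAInstance S P L) (M : Finset (S × P)) (s : S) : Finset P :=
  Finset.univ.filter (fun p => (s, p) ∈ M)

/-- `M(p)`: the students assigned to the project `p`. -/
def projectStudents (_I : SPAInstance S P L) (M : Finset (S × P)) (p : P) : Finset S :=
  Finset.univ.filter (fun s => (s, p) ∈ M)

/-- `M(l)`: the students assigned to some project offered by the lecturer `l`. -/
def lecturerStudents (I : SPAInstance S P L) (M : Finset (S × P)) (l : L) : Finset S :=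
  Finset.univ.filter (fun s => ∃ p, I.lecturer p = l ∧ (s, p) ∈ M)

/-- `M` is a matching: an assignment in which every student has at most one project and no project
or lecturer exceeds its capacity. -/
def IsMatching (I : SPAInstance S P L) (M : Finset (S × P)) : Prop :=
  I.IsAssignment M ∧
  (∀ s, (I.projectsOf M s).card ≤ 1) ∧
  (∀ p, (I.projectStudents M p).card ≤ I.projectCap p) ∧
  (∀ l, (I.lecturerStudents M l).card ≤ I.lecturerCap l)

/-- The project `p` is undersubscribed in `M`. -/
def ProjectUnder (I : SPAInstance S P L) (M : Finset (S × P)) (p : P) : Prop :=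
  (I.projectStudents M p).card < I.projectCap p

/-- The project `p` is full in `M`. -/
def ProjectFull (I : SPAInstance S P L) (M : Finset (S × P)) (p : P) : Prop :=
  (I.projectStudents M p).card = I.projectCap p

/-- The lecturer `l` is undersubscribed in `M`. -/
def LecturerUnder (I : SPAInstance S P L) (M : Finset (S × P)) (l : L) : Prop :=
  (I.lecturerStudents M l).card < I.lecturerCap l

/-- The lecturer `l` is full in `M`. -/
def LecturerFull (I : SPAInstance S P L) (M : Finset (S × P)) (l : L) : Prop :=
  (I.lecturerStudents M l).card = I.lecturerCap l

/-- `w` is the worst student of the set `T` according to the lecturer `l`. -/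
def IsWorst (I : SPAInstance S P L) (l : L) (T : Finset S) (w : S) : Prop :=
  w ∈ T ∧ ∀ t ∈ T, t ≠ w → I.LecturerPrefers l t w

/-- The lecturer `l` prefers `s` to the worst student in `T`. -/
def PrefersToWorst (I : SPAInstance S P L) (l : L) (s : S) (T : Finset S) : Prop :=
  ∃ w, I.IsWorst l T w ∧ I.LecturerPrefers l s w

/-- (S1): `s` is unassigned in `M`. -/
def S1 (I : SPAInstance S P L) (M : Finset (S × P)) (s : S) : Prop :=
  I.projectsOf M s = ∅

/-- (S2): `s` is assigned in `M` and prefers `p` to the assigned project. -/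
def S2 (I : SPAInstance S P L) (M : Finset (S × P)) (s : S) (p : P) : Prop :=
  ∃ q ∈ I.projectsOf M s, I.StudentPrefers s p q

/-- (P1): `p` and its lecturer are both undersubscribed. -/
def P1 (I : SPAInstance S P L) (M : Finset (S × P)) (p : P) : Prop :=
  I.ProjectUnder M p ∧ I.LecturerUnder M (I.lecturer p)

/-- (P2): `p` is undersubscribed, its lecturer is full, and `s` is assigned to that lecturer. -/
def P2 (I : SPAInstance S P L) (M : Finset (S × P)) (s : S) (p : P) : Prop :=
  I.ProjectUnder M p ∧ I.LecturerFull M (I.lecturer p) ∧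
    s ∈ I.lecturerStudents M (I.lecturer p)

/-- (P3): `p` is undersubscribed, its lecturer is full and prefers `s` to the worst student assigned
to that lecturer. -/
def P3 (I : SPAInstance S P L) (M : Finset (S × P)) (s : S) (p : P) : Prop :=
  I.ProjectUnder M p ∧ I.LecturerFull M (I.lecturer p) ∧
    I.PrefersToWorst (I.lecturer p) s (I.lecturerStudents M (I.lecturer p))

/-- (P4): `p` is full, and its lecturer prefers `s` to the worst student assigned to `p`. -/
def P4 (I : SPAInstance S P L) (M : Finset (S × P)) (s : S) (p : P) : Prop :=
  I.ProjectFull M p ∧ I.PrefersToWorst (I.lecturer p) s (I.projectStudents M p)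

/-- The acceptable pair `(s, p)`, not in `M`, blocks `M`. -/
def IsBlockingPair (I : SPAInstance S P L) (M : Finset (S × P)) (s : S) (p : P) : Prop :=
  I.Acceptable s p ∧ (s, p) ∉ M ∧ (I.S1 M s ∨ I.S2 M s p) ∧
    (I.P1 M p ∨ I.P2 M s p ∨ I.P3 M s p ∨ I.P4 M s p)

/-- `M` is a stable matching: a matching that admits no blocking pair. -/
def IsStable (I : SPAInstance S P L) (M : Finset (S × P)) : Prop :=
  I.IsMatching M ∧ ∀ s p, ¬ I.IsBlockingPair M s p

open Classical in
/-- `M ∨ M'`: each student `s` gets the worst project of `M(s) ∪ M'(s)`. So a student unassigned in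
both stays unassigned, a student with the same project in both keeps it, and otherwise the student
gets the worse of the two projects. -/
noncomputable def join (I : SPAInstance S P L) (M M' : Finset (S × P)) : Finset (S × P) :=
  Finset.univ.filter (fun x =>
    x.2 ∈ I.projectsOf M x.1 ∪ I.projectsOf M' x.1 ∧
    ∀ q ∈ I.projectsOf M x.1 ∪ I.projectsOf M' x.1, q ≠ x.2 → I.StudentPrefers x.1 q x.2)

end SPAInstance

/-! For one lecturer, the sets of pairs obeying the project quotas and the lecturer's quota are the
independent sets of a laminar matroid. Order its pairs by the lecturer's preference, ties (same
student) by the student's. Stability of `M` then says that each pair outside `M` is either worse for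
its student than a pair of `M`, or spanned by the pairs of `M` above it.

Let `C` be the lecturers' greedy choice from `M ∪ M'`. A pair of `C` is not spanned from above in `M
∪ M'`, hence not in `M` or `M'`, so its student has that project or a better one in both: `C` lies
in the join. Greedy sets are bases and `M`, `M'` are independent, so `C` is at least as large as
each. Its students are all assigned in `M` and in `M'`, so counting makes the three sets of students
equal, and the join is `C`.

For stability, a pair spanned from above in `M ∪ M'` is spanned from above in `C`, so it cannot
block; for any other pair outside `C`, its student does better in both `M` and `M'`, hence in the
join. -/

theorem card_fiber_insert {α P : Type*} [DecidableEq α] [DecidableEq P] {π : α → P} {Y : Finset α} {a : α} (ha : a ∉ Y) (q : P) :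
    ((insert a Y).filter (fun b => π b = q)).card =
      (Y.filter (fun b => π b = q)).card + if q = π a then 1 else 0 := by
  rw [Finset.filter_insert]
  by_cases h : π a = q
  · rw [if_pos h, if_pos h.symm, Finset.card_insert_of_notMem (by simp [ha])]
  · rw [if_neg h, if_neg (Ne.symm h), add_zero]

/-! ### Greedy bases of a laminar matroid -/

section GreedyChoice

variable {α P κ : Type*} [Fintype P] [DecidableEq P] [LinearOrder κ]

/-- The number of elements of `X` in the fibre of `π` over `q`, truncated at the quota `c q` and
summed over all `q`. -/
def truncatedCard (π : α → P) (c : P → ℕ) (X : Finset α) : ℕ :=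
  ∑ q, min (c q) (X.filter (fun b => π b = q)).card

/-- `a` lies in the span of `X` in the laminar matroid with quotas `c` on the fibres of `π` and
total quota `d`. -/
def Saturated (π : α → P) (c : P → ℕ) (d : ℕ) (X : Finset α) (a : α) : Prop :=
  c (π a) ≤ (X.filter (fun b => π b = π a)).card ∨ d ≤ truncatedCard π c X

open Classical in
/-- The greedy choice from `X`: the elements not spanned by those of smaller key. -/
noncomputable def greedyChoice (k : α → κ) (π : α → P) (c : P → ℕ) (d : ℕ) (X : Finset α) :
    Finset α :=
  X.filter (fun a => ¬ Saturated π c d (X.filter (fun b => k b < k a)) a)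

variable {k : α → κ} {π : α → P} {c : P → ℕ} {d : ℕ}

theorem truncatedCard_mono {X Y : Finset α} (h : X ⊆ Y) :
    truncatedCard π c X ≤ truncatedCard π c Y :=
  Finset.sum_le_sum fun _ _ =>
    min_le_min le_rfl (Finset.card_le_card (Finset.filter_subset_filter _ h))

theorem Saturated.mono {X Y : Finset α} {a : α} (h : X ⊆ Y) (hX : Saturated π c d X a) :
    Saturated π c d Y a :=
  hX.imp (fun h' => h'.trans (Finset.card_le_card (Finset.filter_subset_filter _ h)))
    (fun h' => h'.trans (truncatedCard_mono h))

theorem truncatedCard_eq_card {X : Finset α}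
    (h : ∀ q, (X.filter (fun b => π b = q)).card ≤ c q) : truncatedCard π c X = X.card := by
  rw [Finset.card_eq_sum_card_fiberwise (f := π) (t := Finset.univ) (fun _ _ => by simp)]
  exact Finset.sum_congr rfl fun q _ => min_eq_right (h q)

theorem greedyChoice_subset (X : Finset α) : greedyChoice k π c d X ⊆ X :=
  by classical exact Finset.filter_subset _ _

theorem mem_greedyChoice {X : Finset α} {a : α} : a ∈ greedyChoice k π c d X ↔
    a ∈ X ∧ ¬ Saturated π c d (X.filter (fun b => k b < k a)) a := by
  classical
  unfold greedyChoice
  rw [Finset.mem_filter]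

/-- Whether an element is chosen depends only on elements of smaller key, so truncating at a key
commutes with choosing. -/
theorem filter_greedyChoice (X : Finset α) (x : κ) :
    (greedyChoice k π c d X).filter (fun b => k b < x) =
      greedyChoice k π c d (X.filter (fun b => k b < x)) := by
  ext a
  simp only [Finset.mem_filter, mem_greedyChoice, Finset.filter_filter]
  by_cases h : k a < x
  · have : (X.filter fun b => k b < x ∧ k b < k a) = X.filter fun b => k b < k a :=
      Finset.filter_congr fun b _ => ⟨fun h' => h'.2, fun h' => ⟨h'.trans h, h'⟩⟩
    simp [h, this]
  · simp [h]

variable [DecidableEq α]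

theorem truncatedCard_insert {Y : Finset α} {a : α} (ha : a ∉ Y) :
    truncatedCard π c (insert a Y) = truncatedCard π c Y +
      if c (π a) ≤ (Y.filter (fun b => π b = π a)).card then 0 else 1 := by
  have h1 : ∀ q, min (c q) ((insert a Y).filter (fun b => π b = q)).card =
      min (c q) (Y.filter (fun b => π b = q)).card +
        if q = π a then
          (if c (π a) ≤ (Y.filter (fun b => π b = π a)).card then 0 else 1) else 0 := by
    intro q
    rw [card_fiber_insert ha]
    by_cases h : q = π a
    · subst h
      simp only [if_true]
      split_ifs <;> omega
    · simp [h]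
  unfold truncatedCard
  simp_rw [h1]
  rw [Finset.sum_add_distrib, Finset.sum_ite_eq' Finset.univ (π a)]
  simp

open Classical in
theorem greedyChoice_insert {Y : Finset α} {a : α} (h : ∀ b ∈ Y, k b < k a) :
    greedyChoice k π c d (insert a Y) = if Saturated π c d Y a then greedyChoice k π c d Y
      else insert a (greedyChoice k π c d Y) := by
  have h1 : (insert a Y).filter (fun b => k b < k a) = Y := by
    rw [Finset.filter_insert, if_neg (lt_irrefl _), Finset.filter_true_of_mem h]
  have h2 : ∀ e ∈ Y, (insert a Y).filter (fun b => k b < k e) = Y.filter (fun b => k b < k e) :=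
    fun e he => by rw [Finset.filter_insert, if_neg (h e he).not_gt]
  have ha : a ∉ Y := fun ha => lt_irrefl _ (h a ha)
  ext e
  by_cases hea : e = a
  · subst hea
    split_ifs with hs <;> simp [mem_greedyChoice, h1, hs, ha]
  · split_ifs with hs <;> simp only [mem_greedyChoice, Finset.mem_insert, hea, false_or] <;>
      exact and_congr_right fun he => by rw [h2 e he]

/-- The greedy set is a basis. Adding elements in increasing key order, an element is accepted
exactly when it raises the rank `min d (truncatedCard π c X)`. -/
theorem greedyChoice_rank {X : Finset α} (hX : Set.InjOn k X) :
    (greedyChoice k π c d X).card = min d (truncatedCard π c X) ∧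
      ∀ q, ((greedyChoice k π c d X).filter (fun b => π b = q)).card ≤ c q := by
  classical
  induction X using Finset.induction_on_max_value k with
  | empty => simp [greedyChoice, truncatedCard]
  | insert a Y ha hle ih =>
    obtain ⟨ih1, ih2⟩ := ih (hX.mono (by simp))
    have hlt : ∀ b ∈ Y, k b < k a := fun b hb => (hle b hb).lt_of_ne fun h =>
      ha (hX (by simp [hb]) (by simp) h ▸ hb)
    have ha' : a ∉ greedyChoice k π c d Y := fun h => ha (greedyChoice_subset _ h)
    rw [greedyChoice_insert hlt, truncatedCard_insert ha]
    split_ifs with hs hc hc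
    · exact ⟨by simpa using ih1, ih2⟩
    · refine ⟨?_, ih2⟩
      -- The fibre has room, so the total quota is already reached and the rank stays at `d`.
      have := hs.resolve_left hc
      omega
    · exact absurd (Or.inl hc) hs
    · refine ⟨?_, fun q => ?_⟩
      · rw [Finset.card_insert_of_notMem ha']
        have : ¬ d ≤ truncatedCard π c Y := fun h => hs (Or.inr h)
        omega
      · rw [card_fiber_insert ha']
        split_ifs with hq
        · subst hq
          have := Finset.card_le_card (Finset.filter_subset_filter (fun b => π b = π a)
            (greedyChoice_subset (k := k) (π := π) (c := c) (d := d) Y))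
          omega
        · simpa using ih2 q

/-- A basis spans what the whole set spans. -/
theorem Saturated.greedyChoice {X : Finset α} (hX : Set.InjOn k X) {a : α}
    (h : Saturated π c d X a) : Saturated π c d (greedyChoice k π c d X) a := by
  obtain ⟨h1, h2⟩ := greedyChoice_rank (π := π) (c := c) (d := d) hX
  by_cases hd : d ≤ truncatedCard π c X
  · right
    rw [truncatedCard_eq_card h2, h1, min_eq_left hd]
  · left
    have hc := h.resolve_right hd
    have h3 : truncatedCard π c (_root_.greedyChoice k π c d X) = truncatedCard π c X := by
      rw [truncatedCard_eq_card h2, h1, min_eq_right (by omega)]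
    -- Equal sums of termwise comparable terms agree on every fibre, in particular that of `a`.
    have h4 := (Finset.sum_eq_sum_iff_of_le fun q _ => min_le_min le_rfl
      (Finset.card_le_card (Finset.filter_subset_filter _ (greedyChoice_subset X)))).1 h3
      (π a) (Finset.mem_univ _)
    omega

end GreedyChoice

/-! ### Assignments as sets of matroid elements -/

namespace SPAInstance

variable {S P L : Type*} [Fintype S] [Fintype P] [Fintype L]
  [DecidableEq S] [DecidableEq P] [DecidableEq L] {I : SPAInstance S P L}
  {M M' J : Finset (S × P)}

/-- The rank of a pair from the point of view of the lecturer offering its project: by the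
lecturer's preference between students, and for the same student by the student's preference. -/
def pairKey (I : SPAInstance S P L) (x : S × P) : ℕ ×ₗ ℕ :=
  toLex ((I.lecturerList (I.lecturer x.2)).idxOf x.1, (I.studentList x.1).idxOf x.2)

/-- The pairs of `M` whose project is offered by `l`. -/
def lecturerPairs (I : SPAInstance S P L) (M : Finset (S × P)) (l : L) : Finset (S × P) :=
  M.filter (fun x => I.lecturer x.2 = l)

/-- The pairs of `M` involving the lecturer offering `x.2` that this lecturer ranks above `x`. -/
def betterPairs (I : SPAInstance S P L) (M : Finset (S × P)) (x : S × P) : Finset (S × P) :=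
  (I.lecturerPairs M (I.lecturer x.2)).filter (fun y => I.pairKey y < I.pairKey x)

/-- The pairs of `M` above `x` fill the project or the lecturer of `x`. -/
def LecturerRejects (I : SPAInstance S P L) (M : Finset (S × P)) (x : S × P) : Prop :=
  Saturated Prod.snd I.projectCap (I.lecturerCap (I.lecturer x.2)) (I.betterPairs M x) x

/-- The pairs chosen by the lecturers from `M`. -/
noncomputable def lecturersChoice (I : SPAInstance S P L) (M : Finset (S × P)) :
    Finset (S × P) :=
  Finset.univ.biUnion fun l =>
    greedyChoice I.pairKey Prod.snd I.projectCap (I.lecturerCap l) (I.lecturerPairs M l)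

theorem Precedes.asymm {α : Type*} [DecidableEq α] {l : List α} {a b : α} (h : Precedes l a b) :
    ¬ Precedes l b a := fun h' => absurd h.2.2 h'.2.2.not_gt

theorem Precedes.total {α : Type*} [DecidableEq α] {l : List α} {a b : α} (ha : a ∈ l)
    (hb : b ∈ l) (hab : a ≠ b) : Precedes l a b ∨ Precedes l b a := by
  rcases lt_trichotomy (l.idxOf a) (l.idxOf b) with h | h | h
  · exact Or.inl ⟨ha, hb, h⟩
  · exact absurd ((List.idxOf_inj ha).1 h) hab
  · exact Or.inr ⟨hb, ha, h⟩

theorem mem_lecturerList_of_mem_studentList {s : S} {p : P} (h : p ∈ I.studentList s) :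
    s ∈ I.lecturerList (I.lecturer p) :=
  (I.mem_lecturerList _ _).2 ⟨p, h, rfl⟩

theorem IsAssignment.union (hM : I.IsAssignment M) (hM' : I.IsAssignment M') :
    I.IsAssignment (M ∪ M') := fun s p h =>
  (Finset.mem_union.1 h).elim (hM s p) (hM' s p)

/-- Acceptability matters: `idxOf` gives all absent entries the same value, the length of the list.
-/
theorem IsAssignment.injOn_pairKey (hM : I.IsAssignment M) (l : L) :
    Set.InjOn I.pairKey (I.lecturerPairs M l) := by
  rintro ⟨s, p⟩ hx ⟨t, q⟩ hy h
  simp only [lecturerPairs, Finset.coe_filter, Set.mem_ofPred_eq] at hx hy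
  simp only [pairKey, toLex_inj, Prod.mk.injEq] at h
  obtain ⟨h1, h2⟩ := h
  rw [hx.2, hy.2] at h1
  have hs : s ∈ I.lecturerList l := hx.2 ▸ mem_lecturerList_of_mem_studentList (hM s p hx.1)
  obtain rfl := (List.idxOf_inj hs).1 h1
  obtain rfl := (List.idxOf_inj (hM s p hx.1)).1 h2
  rfl

theorem IsMatching.eq_of_mem (hM : I.IsMatching M) {s : S} {p q : P} (hp : (s, p) ∈ M)
    (hq : (s, q) ∈ M) : p = q :=
  Finset.card_le_one.1 (hM.2.1 s) p (by simpa [projectsOf]) q (by simpa [projectsOf])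

theorem card_projectStudents (M : Finset (S × P)) (p : P) :
    (I.projectStudents M p).card = (M.filter (fun x => x.2 = p)).card := by
  refine Finset.card_bij (fun s _ => (s, p)) ?_ ?_ ?_
  · simp [projectStudents]
  · simp
  · rintro ⟨s, q⟩ h
    simp only [Finset.mem_filter] at h
    obtain ⟨h, rfl⟩ := h
    exact ⟨s, by simpa [projectStudents], rfl⟩

theorem card_lecturerStudents (hM : ∀ s p q, (s, p) ∈ M → (s, q) ∈ M → p = q) (l : L) :
    (I.lecturerStudents M l).card = (I.lecturerPairs M l).card := by
  symm
  refine Finset.card_bij (fun x _ => x.1) ?_ ?_ ?_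
  · rintro ⟨s, p⟩ h
    simp only [lecturerPairs, Finset.mem_filter] at h
    simp only [lecturerStudents, Finset.mem_filter, Finset.mem_univ, true_and]
    exact ⟨p, h.2, h.1⟩
  · rintro ⟨s, p⟩ h ⟨t, q⟩ h' (rfl : s = t)
    simp only [lecturerPairs, Finset.mem_filter] at h h'
    rw [hM s p q h.1 h'.1]
  · intro s h
    simp only [lecturerStudents, Finset.mem_filter, Finset.mem_univ, true_and] at h
    obtain ⟨p, h1, h2⟩ := h
    exact ⟨(s, p), by simp [lecturerPairs, h1, h2], rfl⟩

theorem filter_lecturerPairs (M : Finset (S × P)) (p : P) :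
    (I.lecturerPairs M (I.lecturer p)).filter (fun x => x.2 = p) = M.filter (fun x => x.2 = p) := by
  ext ⟨s, q⟩
  simp only [lecturerPairs, Finset.mem_filter]
  exact ⟨fun h => ⟨h.1.1, h.2⟩, fun h => ⟨⟨h.1, by rw [h.2]⟩, h.2⟩⟩

theorem IsMatching.card_lecturerPairs_le (hM : I.IsMatching M) (l : L) :
    (I.lecturerPairs M l).card ≤ I.lecturerCap l := by
  rw [← card_lecturerStudents fun _ _ _ => hM.eq_of_mem]
  exact hM.2.2.2 l

theorem IsMatching.card_fiber_le (hM : I.IsMatching M) {Y : Finset (S × P)} (hY : Y ⊆ M) (p : P) :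
    (Y.filter (fun x => x.2 = p)).card ≤ I.projectCap p :=
  (Finset.card_le_card (Finset.filter_subset_filter _ hY)).trans
    (card_projectStudents (I := I) M p ▸ hM.2.2.1 p)

theorem betterPairs_subset (M : Finset (S × P)) (x : S × P) : I.betterPairs M x ⊆ M :=
  (Finset.filter_subset _ _).trans (Finset.filter_subset _ _)

theorem IsMatching.lecturerRejects_iff (hM : I.IsMatching M) {x : S × P} :
    I.LecturerRejects M x ↔
      I.projectCap x.2 ≤ ((I.betterPairs M x).filter (fun y => y.2 = x.2)).card ∨
      I.lecturerCap (I.lecturer x.2) ≤ (I.betterPairs M x).card := by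
  unfold LecturerRejects Saturated
  rw [truncatedCard_eq_card (hM.card_fiber_le (betterPairs_subset M x))]

theorem LecturerRejects.mono {x : S × P} (h : M ⊆ M') (hx : I.LecturerRejects M x) :
    I.LecturerRejects M' x :=
  Saturated.mono (Finset.filter_subset_filter _ (Finset.filter_subset_filter _ h)) hx

/-! ### Blocking pairs and rejection -/

theorem prefersToWorst_of_lecturerPrefers {l : L} {T : Finset S}
    (hT : ∀ t ∈ T, t ∈ I.lecturerList l) {s t : S} (ht : t ∈ T) (h : I.LecturerPrefers l s t) :
    I.PrefersToWorst l s T := by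
  obtain ⟨w, hw, hmax⟩ := T.exists_max_image (fun t => (I.lecturerList l).idxOf t) ⟨t, ht⟩
  refine ⟨w, ⟨hw, fun u hu huw => ?_⟩, h.1, hT w hw, h.2.2.trans_le (hmax t ht)⟩
  exact (Precedes.total (hT u hu) (hT w hw) huw).resolve_right
    fun h' => absurd h'.2.2 (hmax u hu).not_gt

theorem lecturerPrefers_of_not_pairKey_lt {s t : S} {p q : P} (hs : p ∈ I.studentList s)
    (ht : q ∈ I.studentList t) (hq : I.lecturer q = I.lecturer p) (hst : t ≠ s)
    (h : ¬ I.pairKey (t, q) < I.pairKey (s, p)) : I.LecturerPrefers (I.lecturer p) s t := by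
  have hs' := mem_lecturerList_of_mem_studentList hs
  have ht' := mem_lecturerList_of_mem_studentList ht
  rw [hq] at ht'
  refine (Precedes.total hs' ht' hst.symm).resolve_right fun h' => h ?_
  simp only [pairKey, Prod.Lex.toLex_lt_toLex, hq]
  exact Or.inl h'.2.2

theorem not_lecturerPrefers_of_pairKey_lt {s t : S} {p q : P}
    (hq : I.lecturer q = I.lecturer p) (h : I.pairKey (t, q) < I.pairKey (s, p)) :
    ¬ I.LecturerPrefers (I.lecturer p) s t := by
  intro h'
  simp only [pairKey, Prod.Lex.toLex_lt_toLex, hq] at h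
  have := h'.2.2
  omega

theorem studentPrefers_of_pairKey_lt {s : S} {p q : P} (hp : p ∈ I.studentList s)
    (hq : q ∈ I.studentList s) (hl : I.lecturer q = I.lecturer p)
    (h : I.pairKey (s, q) < I.pairKey (s, p)) : I.StudentPrefers s q p := by
  simp only [pairKey, Prod.Lex.toLex_lt_toLex, hl, lt_irrefl, true_and, false_or] at h
  exact ⟨hq, hp, h⟩

/-- If neither alternative held, the pair would block: S1 or S2 comes from the student, and one of
P1–P4 from the room left among the pairs above it. -/
theorem IsStable.student_or_lecturer_rejects (hM : I.IsStable M) {s : S} {p : P}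
    (hsp : p ∈ I.studentList s) (h : (s, p) ∉ M) :
    (∃ q, (s, q) ∈ M ∧ I.StudentPrefers s q p) ∨ I.LecturerRejects M (s, p) := by
  by_contra! hcon
  obtain ⟨hS, hL⟩ := hcon
  rw [hM.1.lecturerRejects_iff, not_or, not_le, not_le] at hL
  obtain ⟨hLp, hLl⟩ := hL
  refine hM.2 s p ⟨⟨hsp, mem_lecturerList_of_mem_studentList hsp⟩, h, ?_, ?_⟩
  · rcases (I.projectsOf M s).eq_empty_or_nonempty with h0 | ⟨q, hq⟩
    · exact Or.inl h0
    · refine Or.inr ⟨q, hq, ?_⟩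
      have hq' : (s, q) ∈ M := by simpa [projectsOf] using hq
      exact (Precedes.total hsp (hM.1.1 s q hq') (by rintro rfl; exact h hq')).resolve_right
        (hS q hq')
  · rcases (hM.1.2.2.1 p).lt_or_eq with hp | hp
    · rcases (hM.1.2.2.2 (I.lecturer p)).lt_or_eq with hl | hl
      · exact Or.inl ⟨hp, hl⟩
      · by_cases hsl : s ∈ I.lecturerStudents M (I.lecturer p)
        · exact Or.inr (Or.inl ⟨hp, hl, hsl⟩)
        · refine Or.inr (Or.inr (Or.inl ⟨hp, hl, ?_⟩))
          rw [card_lecturerStudents fun _ _ _ => hM.1.eq_of_mem] at hl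
          -- Otherwise the pairs above `(s, p)` would fill the lecturer.
          have : ∃ y ∈ I.lecturerPairs M (I.lecturer p), ¬ I.pairKey y < I.pairKey (s, p) := by
            by_contra! hall
            rw [betterPairs, Finset.filter_true_of_mem hall] at hLl
            simp only at hLl
            omega
          obtain ⟨⟨t, q⟩, hy, hlt⟩ := this
          simp only [lecturerPairs, Finset.mem_filter] at hy
          have ht : t ∈ I.lecturerStudents M (I.lecturer p) := by
            simp only [lecturerStudents, Finset.mem_filter, Finset.mem_univ, true_and]
            exact ⟨q, hy.2, hy.1⟩
          refine prefersToWorst_of_lecturerPrefers ?_ ht (lecturerPrefers_of_not_pairKey_lt hsp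
            (hM.1.1 t q hy.1) hy.2 (by rintro rfl; exact hsl ht) hlt)
          intro u hu
          simp only [lecturerStudents, Finset.mem_filter, Finset.mem_univ, true_and] at hu
          obtain ⟨r, hr, hur⟩ := hu
          exact hr ▸ mem_lecturerList_of_mem_studentList (hM.1.1 u r hur)
    · refine Or.inr (Or.inr (Or.inr ⟨hp, ?_⟩))
      rw [card_projectStudents] at hp
      have : ∃ y ∈ M.filter (fun x => x.2 = p), ¬ I.pairKey y < I.pairKey (s, p) := by
        by_contra! hall
        rw [betterPairs, Finset.filter_comm, filter_lecturerPairs,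
          Finset.filter_true_of_mem hall] at hLp
        simp only at hLp
        omega
      obtain ⟨⟨t, q⟩, hy, hlt⟩ := this
      simp only [Finset.mem_filter] at hy
      obtain ⟨hy, rfl⟩ := hy
      refine prefersToWorst_of_lecturerPrefers (t := t) ?_ (by simpa [projectStudents])
        (lecturerPrefers_of_not_pairKey_lt hsp (hM.1.1 t q hy) rfl
          (by rintro rfl; exact h hy) hlt)
      intro u hu
      simp only [projectStudents, Finset.mem_filter, Finset.mem_univ, true_and] at hu
      exact mem_lecturerList_of_mem_studentList (hM.1.1 u q hu)

theorem IsMatching.not_isBlockingPair_of_lecturerRejects (hJ : I.IsMatching J) {s : S} {p : P}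
    (h : I.LecturerRejects J (s, p)) : ¬ I.IsBlockingPair J s p := by
  rintro ⟨⟨hsp, -⟩, -, hS, hP⟩
  rw [hJ.lecturerRejects_iff] at h
  have hpc := card_projectStudents (I := I) J p
  have hlc := card_lecturerStudents (I := I) (fun _ _ _ => hJ.eq_of_mem) (I.lecturer p)
  have hlle := hJ.card_lecturerPairs_le (I.lecturer p)
  have hlfull : I.lecturerCap (I.lecturer p) ≤ (I.betterPairs J (s, p)).card →
      ∀ y ∈ I.lecturerPairs J (I.lecturer p), I.pairKey y < I.pairKey (s, p) := fun h' =>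
    Finset.card_filter_eq_iff.1 (le_antisymm (Finset.card_filter_le _ _) (hlle.trans h'))
  -- With `p` undersubscribed, the rejection must come from the lecturer's quota, so all the
  -- lecturer's pairs beat `(s, p)`. This excludes P2 (through the tie-break) and P3.
  have hpu : I.ProjectUnder J p → ∀ q t, I.lecturer q = I.lecturer p → (t, q) ∈ J →
      I.pairKey (t, q) < I.pairKey (s, p) := by
    intro hu q t hq ht
    refine hlfull (h.resolve_left fun h' => ?_) _ (by simp [lecturerPairs, hq, ht])
    have := Finset.card_le_card (Finset.filter_subset_filter (fun y => y.2 = p)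
      (betterPairs_subset (I := I) J (s, p)))
    simp only [ProjectUnder] at hu h'
    omega
  rcases hP with ⟨hu, hl⟩ | ⟨hu, -, hsl⟩ | ⟨hu, -, w, hw, hsw⟩ | ⟨hf, w, hw, hsw⟩
  · have h1 := Finset.card_le_card (Finset.filter_subset_filter (fun y => y.2 = p)
      (betterPairs_subset (I := I) J (s, p)))
    have h2 : (I.betterPairs J (s, p)).card ≤ (I.lecturerPairs J (I.lecturer p)).card :=
      Finset.card_filter_le _ _
    simp only [ProjectUnder, LecturerUnder] at hu hl h
    omega
  · simp only [lecturerStudents, Finset.mem_filter, Finset.mem_univ, true_and] at hsl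
    obtain ⟨q, hq, hsq⟩ := hsl
    rcases hS with hS | ⟨q', hq', hpq⟩
    · have : q ∈ I.projectsOf J s := by simpa [projectsOf]
      simp [S1] at hS
      simp [hS] at this
    · obtain rfl := hJ.eq_of_mem hsq (by simpa [projectsOf] using hq')
      exact Precedes.asymm (studentPrefers_of_pairKey_lt hsp (hJ.1 s q hsq) hq
        (hpu hu q s hq hsq)) hpq
  · have hw' := hw.1
    simp only [lecturerStudents, Finset.mem_filter, Finset.mem_univ, true_and] at hw'
    obtain ⟨q, hq, hwq⟩ := hw'
    exact not_lecturerPrefers_of_pairKey_lt hq (hpu hu q w hq hwq) hsw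
  · have hw' : (w, p) ∈ J := by simpa [projectStudents] using hw.1
    refine not_lecturerPrefers_of_pairKey_lt rfl ?_ hsw
    rcases h with h | h
    · rw [betterPairs, Finset.filter_comm, filter_lecturerPairs] at h
      simp only [ProjectFull] at hf h
      rw [card_projectStudents] at hf
      exact Finset.card_filter_eq_iff.1 (le_antisymm (Finset.card_filter_le _ _) (hf.trans_le h)) _
        (by simpa using hw')
    · exact hlfull h _ (by simpa [lecturerPairs] using hw')

/-! ### The lecturers' combined choice -/

theorem mem_lecturersChoice {x : S × P} :
    x ∈ I.lecturersChoice M ↔ x ∈ M ∧ ¬ I.LecturerRejects M x := by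
  simp only [lecturersChoice, Finset.mem_biUnion, Finset.mem_univ, true_and, mem_greedyChoice,
    lecturerPairs, Finset.mem_filter]
  constructor
  · rintro ⟨l, ⟨h1, rfl⟩, h2⟩
    exact ⟨h1, h2⟩
  · rintro ⟨h1, h2⟩
    exact ⟨_, ⟨h1, rfl⟩, h2⟩

theorem lecturerPairs_lecturersChoice (M : Finset (S × P)) (l : L) :
    I.lecturerPairs (I.lecturersChoice M) l =
      greedyChoice I.pairKey Prod.snd I.projectCap (I.lecturerCap l) (I.lecturerPairs M l) := by
  ext x
  simp only [lecturerPairs, Finset.mem_filter, mem_lecturersChoice, mem_greedyChoice]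
  constructor
  · rintro ⟨⟨h1, h2⟩, rfl⟩
    exact ⟨⟨h1, rfl⟩, h2⟩
  · rintro ⟨⟨h1, rfl⟩, h2⟩
    exact ⟨⟨h1, h2⟩, rfl⟩

theorem IsAssignment.lecturerRejects_lecturersChoice (hM : I.IsAssignment M) {x : S × P}
    (h : I.LecturerRejects M x) : I.LecturerRejects (I.lecturersChoice M) x := by
  unfold LecturerRejects betterPairs
  rw [lecturerPairs_lecturersChoice, filter_greedyChoice]
  exact Saturated.greedyChoice ((hM.injOn_pairKey (I.lecturer x.2)).mono
    (Finset.coe_subset.2 (Finset.filter_subset _ _))) h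

/-- Each lecturer's part of `M` is independent, and rank is monotone. -/
theorem IsAssignment.card_le_card_lecturersChoice (hM' : I.IsAssignment M') (hM : I.IsMatching M)
    (h : M ⊆ M') : M.card ≤ (I.lecturersChoice M').card := by
  rw [Finset.card_eq_sum_card_fiberwise (f := fun x => I.lecturer x.2) (t := Finset.univ)
    (fun _ _ => by simp), Finset.card_eq_sum_card_fiberwise (s := I.lecturersChoice M')
    (f := fun x => I.lecturer x.2) (t := Finset.univ) (fun _ _ => by simp)]
  refine Finset.sum_le_sum fun l _ => ?_
  change (I.lecturerPairs M l).card ≤ (I.lecturerPairs (I.lecturersChoice M') l).card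
  rw [lecturerPairs_lecturersChoice, (greedyChoice_rank (hM'.injOn_pairKey l)).1]
  refine le_min (hM.card_lecturerPairs_le l) ?_
  rw [← truncatedCard_eq_card (hM.card_fiber_le (Y := I.lecturerPairs M l)
    (Finset.filter_subset _ _))]
  exact truncatedCard_mono (Finset.filter_subset_filter _ h)

theorem IsAssignment.isMatching_lecturersChoice (hM : I.IsAssignment M)
    (h : ∀ s p q, (s, p) ∈ I.lecturersChoice M → (s, q) ∈ I.lecturersChoice M → p = q) :
    I.IsMatching (I.lecturersChoice M) := by
  refine ⟨fun s p hp => hM s p (mem_lecturersChoice.1 hp).1, fun s => ?_, fun p => ?_,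
    fun l => ?_⟩
  · exact Finset.card_le_one.2 fun p hp q hq =>
      h s p q (by simpa [projectsOf] using hp) (by simpa [projectsOf] using hq)
  · rw [card_projectStudents, ← filter_lecturerPairs (I := I), lecturerPairs_lecturersChoice]
    exact (greedyChoice_rank (hM.injOn_pairKey _)).2 p
  · rw [card_lecturerStudents h, lecturerPairs_lecturersChoice,
      (greedyChoice_rank (hM.injOn_pairKey _)).1]
    exact min_le_left _ _

theorem IsStable.mem_and_prefers_of_mem_lecturersChoice (hM : I.IsStable M) (hM' : I.IsStable M')
    {s : S} {p : P} (h : (s, p) ∈ I.lecturersChoice (M ∪ M')) :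
    (∃ q, (s, q) ∈ M ∧ (q = p ∨ I.StudentPrefers s q p)) ∧
      ∃ q, (s, q) ∈ M' ∧ (q = p ∨ I.StudentPrefers s q p) := by
  obtain ⟨h1, h2⟩ := mem_lecturersChoice.1 h
  have hsp := (hM.1.1.union hM'.1.1) s p h1
  have key : ∀ N, I.IsStable N → N ⊆ M ∪ M' →
      ∃ q, (s, q) ∈ N ∧ (q = p ∨ I.StudentPrefers s q p) := by
    intro N hN hsub
    by_cases hmem : (s, p) ∈ N
    · exact ⟨p, hmem, Or.inl rfl⟩
    · obtain ⟨q, hq, hqp⟩ := (hN.student_or_lecturer_rejects hsp hmem).resolve_right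
        fun h' => h2 (h'.mono hsub)
      exact ⟨q, hq, Or.inr hqp⟩
  exact ⟨key M hM Finset.subset_union_left, key M' hM' Finset.subset_union_right⟩

/-! ### The join is the lecturers' choice -/

theorem mem_join {s : S} {p : P} : (s, p) ∈ I.join M M' ↔
    ((s, p) ∈ M ∨ (s, p) ∈ M') ∧
      ∀ q, (s, q) ∈ M ∨ (s, q) ∈ M' → q ≠ p → I.StudentPrefers s q p := by
  classical
  unfold join
  rw [Finset.mem_filter]
  simp [projectsOf]

theorem join_unique {s : S} {p q : P} (hp : (s, p) ∈ I.join M M') (hq : (s, q) ∈ I.join M M') :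
    p = q := by
  rw [mem_join] at hp hq
  by_contra hne
  exact Precedes.asymm (hp.2 q hq.1 (Ne.symm hne)) (hq.2 p hp.1 hne)

theorem IsStable.join_eq_lecturersChoice (hM : I.IsStable M) (hM' : I.IsStable M') :
    I.join M M' = I.lecturersChoice (M ∪ M') := by
  have hsub : I.lecturersChoice (M ∪ M') ⊆ I.join M M' := by
    rintro ⟨s, p⟩ h
    obtain ⟨⟨q, hq, hqp⟩, ⟨q', hq', hqp'⟩⟩ := hM.mem_and_prefers_of_mem_lecturersChoice hM' h
    refine mem_join.2 ⟨Finset.mem_union.1 (mem_lecturersChoice.1 h).1, ?_⟩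
    rintro r (hr | hr) hne
    · obtain rfl := hM.1.eq_of_mem hr hq
      exact hqp.resolve_left hne
    · obtain rfl := hM'.1.eq_of_mem hr hq'
      exact hqp'.resolve_left hne
  have hinj : Set.InjOn Prod.fst (I.lecturersChoice (M ∪ M') : Set (S × P)) := by
    rintro ⟨s, p⟩ hx ⟨t, q⟩ hy (rfl : s = t)
    rw [join_unique (hsub hx) (hsub hy)]
  -- The choice has at least `N.card` pairs, with distinct students, so inclusion of the student
  -- sets forces equality.
  have himg : ∀ N, I.IsStable N → N ⊆ M ∪ M' →
      (I.lecturersChoice (M ∪ M')).image Prod.fst ⊆ N.image Prod.fst →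
      (I.lecturersChoice (M ∪ M')).image Prod.fst = N.image Prod.fst := by
    intro N hN hNsub himg
    refine Finset.eq_of_subset_of_card_le himg ?_
    rw [Finset.card_image_of_injOn hinj]
    exact Finset.card_image_le.trans
      ((hM.1.1.union hM'.1.1).card_le_card_lecturersChoice hN.1 hNsub)
  have h1 := himg M hM Finset.subset_union_left fun s hs => by
    obtain ⟨⟨s, p⟩, hp, rfl⟩ := Finset.mem_image.1 hs
    obtain ⟨q, hq, -⟩ := (hM.mem_and_prefers_of_mem_lecturersChoice hM' hp).1
    exact Finset.mem_image.2 ⟨(s, q), hq, rfl⟩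
  have h2 := himg M' hM' Finset.subset_union_right fun s hs => by
    obtain ⟨⟨s, p⟩, hp, rfl⟩ := Finset.mem_image.1 hs
    obtain ⟨q, hq, -⟩ := (hM.mem_and_prefers_of_mem_lecturersChoice hM' hp).2
    exact Finset.mem_image.2 ⟨(s, q), hq, rfl⟩
  refine Finset.Subset.antisymm ?_ hsub
  rintro ⟨s, p⟩ h
  have hs : s ∈ (I.lecturersChoice (M ∪ M')).image Prod.fst := by
    rcases (mem_join.1 h).1 with h' | h'
    · exact h1 ▸ Finset.mem_image_of_mem Prod.fst h'
    · exact h2 ▸ Finset.mem_image_of_mem Prod.fst h'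
  obtain ⟨⟨t, q⟩, hq, rfl⟩ := Finset.mem_image.1 hs
  rwa [join_unique h (hsub hq)]

theorem IsStable.join (hM : I.IsStable M) (hM' : I.IsStable M') : I.IsStable (I.join M M') := by
  have hJ := hM.join_eq_lecturersChoice hM'
  have hA := hM.1.1.union hM'.1.1
  have hmat : I.IsMatching (I.join M M') := by
    have huniq : ∀ s p q, (s, p) ∈ I.join M M' → (s, q) ∈ I.join M M' → p = q :=
      fun _ _ _ => join_unique
    rw [hJ] at huniq ⊢
    exact hA.isMatching_lecturersChoice huniq
  refine ⟨hmat, fun s p hb => ?_⟩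
  by_cases hrej : I.LecturerRejects (M ∪ M') (s, p)
  · exact hmat.not_isBlockingPair_of_lecturerRejects
      (hJ ▸ hA.lecturerRejects_lecturersChoice hrej) hb
  · obtain ⟨⟨hsp, -⟩, hnot, hS, -⟩ := hb
    have hX : (s, p) ∉ M ∪ M' := fun h => hnot (hJ ▸ mem_lecturersChoice.2 ⟨h, hrej⟩)
    rw [Finset.mem_union, not_or] at hX
    obtain ⟨q, hq, hqp⟩ := (hM.student_or_lecturer_rejects hsp hX.1).resolve_right
      fun h => hrej (h.mono Finset.subset_union_left)
    obtain ⟨q', hq', hqp'⟩ := (hM'.student_or_lecturer_rejects hsp hX.2).resolve_right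
      fun h => hrej (h.mono Finset.subset_union_right)
    have hpref : ∀ r, (s, r) ∈ I.join M M' → I.StudentPrefers s r p := by
      intro r hr
      rcases (mem_join.1 hr).1 with h | h
      · rwa [hM.1.eq_of_mem h hq]
      · rwa [hM'.1.eq_of_mem h hq']
    rcases hS with hS | ⟨r, hr, hpr⟩
    · have hne : ∃ r, (s, r) ∈ I.join M M' := by
        by_cases hqq : q = q'
        · subst hqq
          refine ⟨q, mem_join.2 ⟨Or.inl hq, ?_⟩⟩
          rintro r (hr | hr) hne
          · exact absurd (hM.1.eq_of_mem hr hq) hne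
          · exact absurd (hM'.1.eq_of_mem hr hq') hne
        · rcases Precedes.total (hM.1.1 s q hq) (hM'.1.1 s q' hq') hqq with h | h
          · refine ⟨q', mem_join.2 ⟨Or.inr hq', ?_⟩⟩
            rintro r (hr | hr) hne
            · rwa [hM.1.eq_of_mem hr hq]
            · exact absurd (hM'.1.eq_of_mem hr hq') hne
          · refine ⟨q, mem_join.2 ⟨Or.inl hq, ?_⟩⟩
            rintro r (hr | hr) hne
            · exact absurd (hM.1.eq_of_mem hr hq) hne
            · rwa [hM'.1.eq_of_mem hr hq']
      obtain ⟨r, hr⟩ := hne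
      have hr' : r ∈ I.projectsOf (I.join M M') s := by simpa [projectsOf]
      rw [S1] at hS
      simp [hS] at hr'
    · exact Precedes.asymm (hpref r (by simpa [projectsOf] using hr)) hpr

end SPAInstance

theorem mainTheorem2 {S P L : Type*} [Fintype S] [Fintype P] [Fintype L]
    [DecidableEq S] [DecidableEq P] [DecidableEq L] (I : SPAInstance S P L)
    (M M' : Finset (S × P)) (hM : I.IsStable M) (hM' : I.IsStable M') :
    I.IsMatching (I.join M M') ∧
    (∀ s p, ¬ I.IsBlockingPair (I.join M M') s p) ∧
    I.IsStable (I.join M M') :=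
  ⟨(hM.join hM').1, (hM.join hM').2, hM.join hM'⟩
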